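/- **Lemma 3.2.** A weight on $\mathbb{R}^n$ is a locally integrable function $\omega$ with $\omega>0$ almost everywhere; write $\omega(E)=\int_E\omega(x)\,dx$, and let $Q$ range over the cubes in $\mathbb{R}^n$ with sides parallel to the axes. For $1<s<\infty$, $\omega\in A_s$ means $$\sup_Q\Big(\frac1{|Q|}\int_Q\omega\,dx\Big)\Big(\frac1{|Q|}\int_Q\omega^{-\frac1{s-1}}\,dx\Big)^{s-1}<\infty,$$ $\omega\in A_1$ means $\sup_Q\big(\frac1{|Q|}\int_Q\omega\,dx\big)\,\mathrm{ess\,sup}_{x\in Q}\,\omega(x)^{-1}<\infty$, and $A_\infty=\bigcup_{1\le s<\infty}A_s$. Let $\omega\in A_\infty$ and $0<p<\infty$. For a measurable real- or complex-valued function $f$ on $\mathbb{R}^n$, put $$\|f\|_{BMO}=\sup_Q\frac1{|Q|}\int_Q|f(x)-f_Q|\,dx,\qquad f_Q=\frac1{|Q|}\int_Qf(x)\,dx,$$ if $f$ is locally integrable, $\|f\|_{BMO}=\infty$ otherwise, and $$\|f\|_{BMO^{p}_{\omega,*}}=\sup_Q\,\sup_{\lambda>0}\,\inf_c\,\frac{\lambda}{\omega(Q)^{1/p}}\,\omega\big(\{x\in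 Q:|f(x)-c|>\lambda\}\big)^{1/p},$$ where the infimum is over all scalars $c$ (which may depend on $Q$ and $\lambda$). Then there is a constant $0<C<\infty$, depending only on $n$, $p$ and $\omega$, such that for every measurable $f$ $$C^{-1}\,\|f\|_{BMO}\le\|f\|_{BMO^{p}_{\omega,*}}\le C\,\|f\|_{BMO}.$$ In particular, $f\in BMO$ (that is, $\|f\|_{BMO}<\infty$) if and only if $\|f\|_{BMO^{p}_{\omega,*}}<\infty$. -/

import Mathlib

open MeasureTheory
open scoped ENNReal

noncomputable section

/-- The (closed) cube `Q(x, r)` in `ℝⁿ` with centre `x`, side length `r`, and sides parallel to the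
axes. -/
def cube {n : ℕ} (x : Fin n → ℝ) (r : ℝ) : Set (Fin n → ℝ) :=
  {y | ∀ i, |y i - x i| ≤ r / 2}

/-- A weight on `ℝⁿ`: a locally integrable function that is positive almost everywhere. -/
def IsWeight {n : ℕ} (w : (Fin n → ℝ) → ℝ) : Prop :=
  LocallyIntegrable w volume ∧ ∀ᵐ x ∂(volume : Measure (Fin n → ℝ)), 0 < w x

/-- The measure `w(E) = ∫_E w(x) dx`. -/
def weightMeasure {n : ℕ} (w : (Fin n → ℝ) → ℝ) : Measure (Fin n → ℝ) :=
  volume.withDensity fun x => ENNReal.ofReal (w x)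

/-- The constant `[w]_{A_p}` for `1 < p < ∞`, with values in `[0, ∞]`. -/
def apConst {n : ℕ} (p : ℝ) (w : (Fin n → ℝ) → ℝ) : ℝ≥0∞ :=
  ⨆ (x : Fin n → ℝ) (r : ℝ) (_ : 0 < r),
    (⨍⁻ y in cube x r, ENNReal.ofReal (w y) ∂volume) *
      (⨍⁻ y in cube x r, ENNReal.ofReal (w y) ^ (-(1 / (p - 1))) ∂volume) ^ (p - 1)

/-- The constant `[w]_{A_1}`, with values in `[0, ∞]`. -/
def aOneConst {n : ℕ} (w : (Fin n → ℝ) → ℝ) : ℝ≥0∞ :=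
  ⨆ (x : Fin n → ℝ) (r : ℝ) (_ : 0 < r),
    (⨍⁻ y in cube x r, ENNReal.ofReal (w y) ∂volume) *
      essSup (fun y => (ENNReal.ofReal (w y))⁻¹) (volume.restrict (cube x r))

/-- The class `A_p`, `1 ≤ p < ∞`, of Muckenhoupt weights. -/
def IsAp {n : ℕ} (p : ℝ) (w : (Fin n → ℝ) → ℝ) : Prop :=
  IsWeight w ∧ ((p = 1 ∧ aOneConst w < ∞) ∨ (1 < p ∧ apConst p w < ∞))

/-- The class `A_∞ = ⋃_{1 ≤ p < ∞} A_p`. -/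
def IsAInfty {n : ℕ} (w : (Fin n → ℝ) → ℝ) : Prop :=
  ∃ p : ℝ, 1 ≤ p ∧ IsAp p w

open Classical in
/-- The norm `‖f‖_BMO = sup_Q (1/|Q|) ∫_Q |f - f_Q|` of a locally integrable function `f`, with
values in `[0, ∞]`; it is `∞` when `f` is not locally integrable. Thus `f ∈ BMO` means
`bmoNorm f < ∞`. -/
def bmoNorm {n : ℕ} {𝕜 : Type*} [RCLike 𝕜] (f : (Fin n → ℝ) → 𝕜) : ℝ≥0∞ :=
  if LocallyIntegrable f volume then
    ⨆ (x : Fin n → ℝ) (r : ℝ) (_ : 0 < r),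
      ⨍⁻ y in cube x r, ‖f y - ⨍ z in cube x r, f z ∂volume‖ₑ ∂volume
  else ∞

/-- The weak-type weighted oscillation
`sup_Q sup_{t > 0} inf_c (t / w(Q)^{1/p}) w({y ∈ Q : |f(y) - c| > t})^{1/p}`, with values
in `[0, ∞]`. The constant `c` may depend on both `Q` and `t`. -/
def weakOscNorm {n : ℕ} {𝕜 : Type*} [RCLike 𝕜] (w : (Fin n → ℝ) → ℝ) (p : ℝ)
    (f : (Fin n → ℝ) → 𝕜) : ℝ≥0∞ :=
  ⨆ (x : Fin n → ℝ) (r : ℝ) (_ : 0 < r) (t : ℝ) (_ : 0 < t), ⨅ c : 𝕜,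
    ENNReal.ofReal t / weightMeasure w (cube x r) ^ (1 / p) *
      weightMeasure w {y | y ∈ cube x r ∧ t < ‖f y - c‖} ^ (1 / p)

end

open Set Filter Metric Topology

/-! Both inequalities pass through one unweighted condition at a single level `L`: on every cube `Q`
there is a constant `c_Q` with `|f - c_Q| ≤ L` off a subset of density at most `2^{-(4n+2)}`. By
`john_stromberg` this already forces `|{y ∈ Q : |f - c_Q| > (2k+1)L}| ≤ 2^{-k}|Q|` for all `k`,
hence a BMO bound `10 L` (`bmoNorm_le_of_small_density`).

The weight enters through `(|E|/|Q|)^s ≤ C w(E)/w(Q)` for `E ⊆ Q`. To bound BMO, the weak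
oscillation at one well-chosen level gives small `w`-density, hence small Lebesgue density. Only one
level is used on each cube, so the dependence of `c` on the level is harmless.

To bound the weak oscillation, Chebyshev gives the condition with `c_Q = f_Q`, and `john_stromberg`
gives exponential decay in Lebesgue measure. Iterating the comparison
(`IsAInfty.exists_weightMeasure_le_pow_mul`) turns it into geometric decay in `w`-measure, which
beats every power of the level. -/

/-! ### Cubes as sup-norm balls, and the Calderón–Zygmund covering. -/

lemma cube_eq_closedBall {n : ℕ} (x : Fin n → ℝ) {r : ℝ} (hr : 0 ≤ r) :
    cube x r = closedBall x (r / 2) := by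
  ext y
  simp [cube, mem_closedBall, dist_pi_le_iff (by positivity : 0 ≤ r / 2), Real.dist_eq]

lemma volume_closedBall_two_pow_mul {n : ℕ} (x y : Fin n → ℝ) {r : ℝ} (hr : 0 ≤ r) (j : ℕ) :
    volume (closedBall x (2 ^ j * r)) = 2 ^ (j * n) * volume (closedBall y r) := by
  rw [Real.volume_pi_closedBall _ (by positivity), Real.volume_pi_closedBall _ hr, Fintype.card_fin,
    show (2 * (2 ^ j * r)) ^ n = 2 ^ (j * n) * (2 * r) ^ n by rw [pow_mul]; ring,
    ENNReal.ofReal_mul (by positivity), ENNReal.ofReal_pow (by norm_num)]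
  simp

lemma volume_closedBall_pos {n : ℕ} (x : Fin n → ℝ) {r : ℝ} (hr : 0 < r) :
    0 < volume (closedBall x r) :=
  measure_closedBall_pos _ _ hr

lemma volume_closedBall_ne_top {n : ℕ} (x : Fin n → ℝ) (r : ℝ) :
    volume (closedBall x r) ≠ ∞ :=
  measure_closedBall_lt_top.ne

/-- A cube centred at a point of `Q` can be shifted so as to lie inside `Q` without losing any point
of `Q`. -/
lemma exists_closedBall_subset_inter_subset {n : ℕ} (x₀ x : Fin n → ℝ) {R r : ℝ} (hr : 0 < r)
    (hrR : r ≤ R) :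
    ∃ z : Fin n → ℝ, closedBall z r ⊆ closedBall x₀ R ∧
      closedBall x r ∩ closedBall x₀ R ⊆ closedBall z r ∧ (r = R → z = x₀) := by
  have hR : 0 < R := hr.trans_le hrR
  -- The new centre is `x` clamped coordinatewise to the centres admissible for radius `r`.
  refine ⟨fun i => max (x₀ i - (R - r)) (min (x i) (x₀ i + (R - r))), ?_, ?_, ?_⟩
  · intro y hy
    rw [mem_closedBall, dist_pi_le_iff hr.le] at hy
    rw [mem_closedBall, dist_pi_le_iff hR.le]
    intro i
    have := hy i
    simp only [Real.dist_eq, abs_le] at this ⊢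
    rcases max_cases (x₀ i - (R - r)) (min (x i) (x₀ i + (R - r))) with h | h <;>
    rcases min_cases (x i) (x₀ i + (R - r)) with h' | h' <;>
    constructor <;> linarith
  · rintro y ⟨hy, hy'⟩
    rw [mem_closedBall, dist_pi_le_iff hr.le] at hy
    rw [mem_closedBall, dist_pi_le_iff hR.le] at hy'
    rw [mem_closedBall, dist_pi_le_iff hr.le]
    intro i
    have h1 := hy i
    have h2 := hy' i
    simp only [Real.dist_eq, abs_le] at h1 h2 ⊢
    rcases max_cases (x₀ i - (R - r)) (min (x i) (x₀ i + (R - r))) with h | h <;>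
    rcases min_cases (x i) (x₀ i + (R - r)) with h' | h' <;>
    constructor <;> linarith
  · rintro rfl
    ext i
    simp

/-- Calderón–Zygmund covering: a set of small density in a cube `Q` is covered, up to a null set, by
subcubes `closedBall (ζ a) (σ a)` of `Q` of comparable total volume, each of which contains a
comparable cube `closedBall (z a) (r a)`, the latter being disjoint, and in all of these the set has
density at most one half. -/
lemma exists_calderon_zygmund_cover {n : ℕ} (x₀ : Fin n → ℝ) {R : ℝ} (hR : 0 < R)
    {E : Set (Fin n → ℝ)} (hEQ : E ⊆ closedBall x₀ R)
    (hE : 2 ^ (n + 1) * volume E ≤ volume (closedBall x₀ R)) :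
    ∃ (t : Set (Fin n → ℝ)) (z ζ : (Fin n → ℝ) → (Fin n → ℝ)) (r σ : (Fin n → ℝ) → ℝ),
      t.Countable ∧ t.PairwiseDisjoint (fun a => closedBall (z a) (r a)) ∧
      (∀ a ∈ t, 0 < r a ∧ 0 < σ a ∧ closedBall (z a) (r a) ⊆ closedBall (ζ a) (σ a) ∧
        closedBall (ζ a) (σ a) ⊆ closedBall x₀ R ∧
        volume (closedBall (ζ a) (σ a)) ≤ 2 ^ (3 * n) * volume (closedBall (z a) (r a)) ∧
        2 * volume (E ∩ closedBall (z a) (r a)) ≤ volume (closedBall (z a) (r a)) ∧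
        2 * volume (E ∩ closedBall (ζ a) (σ a)) ≤ volume (closedBall (ζ a) (σ a))) ∧
      volume (E \ ⋃ a ∈ t, closedBall (ζ a) (σ a)) = 0 ∧
      ∑' a : t, volume (closedBall (ζ a) (σ a)) ≤ 2 ^ (4 * n + 1) * volume E := by
  set ρ : ℕ → ℝ := fun k => R / 2 ^ k with hρ
  have hρpos : ∀ k, 0 < ρ k := fun k => by positivity
  have hρanti : Antitone ρ := fun i j hij => by
    simp only [hρ]; gcongr; norm_num
  have hρ0 : ρ 0 = R := by simp [hρ]
  have hρR : ∀ k, ρ k ≤ R := fun k => hρ0 ▸ hρanti (Nat.zero_le k)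
  have hρadd : ∀ k j, ρ k = 2 ^ j * ρ (k + j) := fun k j => by
    simp only [hρ, pow_add]; field_simp
  choose Z hZsub hZsup hZ0 using fun (x : Fin n → ℝ) (k : ℕ) =>
    exists_closedBall_subset_inter_subset x₀ x (hρpos k) (hρR k)
  set P : (Fin n → ℝ) → ℕ → Set (Fin n → ℝ) := fun x k => closedBall (Z x k) (ρ k) with hP
  have hP0 : ∀ x, P x 0 = closedBall x₀ R := fun x => by
    simp only [hP]; rw [hZ0 x 0 hρ0, hρ0]
  have hxP : ∀ x ∈ E, ∀ k, x ∈ P x k := fun x hx k =>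
    hZsup x k ⟨mem_closedBall_self (hρpos k).le, hEQ hx⟩
  have hvol : ∀ x y k j, volume (P x k) = 2 ^ (j * n) * volume (P y (k + j)) := fun x y k j => by
    simp only [hP]; rw [hρadd k j]; exact volume_closedBall_two_pow_mul _ _ (hρpos _).le j
  have hstep : ∀ x ∈ E, ∀ i j, i + 1 ≤ j → P x j ⊆ P x i := by
    intro x hx i j hij y hy
    refine hZsup x i ⟨?_, hZsub x j hy⟩
    have h1 : dist y (Z x j) ≤ ρ j := hy
    have h2 : dist x (Z x j) ≤ ρ j := hxP x hx j
    have h3 := hρanti hij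
    have h4 := hρadd i 1
    have h5 := dist_triangle_right y x (Z x j)
    rw [mem_closedBall]; linarith
  have hmono : ∀ x ∈ E, ∀ i j, i ≤ j → P x j ⊆ P x i := by
    intro x hx i j hij
    rcases hij.eq_or_lt with rfl | h
    · exact Subset.rfl
    · exact hstep x hx i j h
  -- Points seeing density above `2^{-(n+1)}` at some scale; by Lebesgue density they are almost all
  -- of `E`.
  set t₀ : Set (Fin n → ℝ) :=
    {x | x ∈ E ∧ ∃ k, volume (P x k) < 2 ^ (n + 1) * volume (E ∩ P x k)} with ht₀
  have hnull : volume (E \ t₀) = 0 := by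
    have hlim := IsUnifLocDoublingMeasure.ae_tendsto_measure_inter_div
      (volume : Measure (Fin n → ℝ)) E 1
    have hsub : E \ t₀ ⊆ {x | ¬ (∀ {ι : Type} {l : Filter ι} (w : ι → (Fin n → ℝ)) (δ : ι → ℝ)
        (_ : Tendsto δ l (𝓝[>] 0)) (_ : ∀ᶠ j in l, x ∈ closedBall (w j) (1 * δ j)),
        Tendsto (fun j => volume (E ∩ closedBall (w j) (δ j)) / volume (closedBall (w j) (δ j)))
          l (𝓝 1))} ∩ E := by
      rintro x ⟨hxE, hxt⟩
      refine ⟨fun hx => hxt ⟨hxE, ?_⟩, hxE⟩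
      have hδ : Tendsto ρ atTop (𝓝[>] 0) := by
        refine tendsto_nhdsWithin_iff.2 ⟨?_, Eventually.of_forall hρpos⟩
        have := (tendsto_pow_atTop_nhds_zero_of_lt_one (r := (1 / 2 : ℝ)) (by norm_num)
          (by norm_num)).const_mul R
        simpa [hρ, div_eq_mul_inv] using this
      have h1 := hx (l := atTop) (Z x) ρ hδ (Eventually.of_forall fun k => by
        rw [one_mul]; exact hxP x hxE k)
      have h2 : ((2 : ℝ≥0∞) ^ (n + 1))⁻¹ < 1 := by
        rw [ENNReal.inv_lt_one]
        exact_mod_cast Nat.one_lt_two_pow (Nat.succ_ne_zero n)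
      obtain ⟨k, hk⟩ := (h1.eventually (lt_mem_nhds h2)).exists
      refine ⟨k, ?_⟩
      rw [ENNReal.lt_div_iff_mul_lt (Or.inl (volume_closedBall_pos _ (hρpos k)).ne')
        (Or.inl (volume_closedBall_ne_top _ _)), mul_comm, ← div_eq_mul_inv,
        ENNReal.div_lt_iff (Or.inl (by positivity)) (Or.inl (by finiteness)), mul_comm] at hk
      exact hk
    refine measure_mono_null hsub (le_antisymm ((Measure.le_restrict_apply _ _).trans ?_) zero_le)
    exact (ae_iff.1 hlim).le
  classical
  -- The stopping time: the first scale of high density. The default `0` is never used on `t₀`.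
  set κ : (Fin n → ℝ) → ℕ := fun x =>
    if h : ∃ k, volume (P x k) < 2 ^ (n + 1) * volume (E ∩ P x k) then Nat.find h else 0 with hκ
  have hκ1 : ∀ x ∈ t₀, volume (P x (κ x)) < 2 ^ (n + 1) * volume (E ∩ P x (κ x)) := by
    intro x hx
    simp only [hκ, dif_pos hx.2]
    exact Nat.find_spec hx.2
  have hκ2 : ∀ x ∈ t₀, ∀ j < κ x, 2 ^ (n + 1) * volume (E ∩ P x j) ≤ volume (P x j) := by
    intro x hx j hj
    simp only [hκ, dif_pos hx.2] at hj
    exact not_lt.1 (Nat.find_min hx.2 hj)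
  have hκpos : ∀ x ∈ t₀, 1 ≤ κ x := by
    intro x hx
    by_contra! h
    have h0 : κ x = 0 := by omega
    have h1 := hκ1 x hx
    rw [h0, hP0, inter_eq_left.2 hEQ] at h1
    exact absurd hE (not_le.2 h1)
  obtain ⟨u, hut, hud, hucov⟩ := Vitali.exists_disjoint_subfamily_covering_enlargement_closedBall
    t₀ (fun x => Z x (κ x)) (fun x => ρ (κ x)) R (fun a _ => hρR _) 5 (by norm_num)
  have hucount : u.Countable := hud.countable_of_nonempty_interior fun a _ =>
    (nonempty_ball.2 (hρpos (κ a))).mono ball_subset_interior_closedBall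
  have htwo : (2 : ℝ≥0∞) ≤ 2 ^ (n + 1) := by
    exact_mod_cast Nat.le_self_pow (Nat.succ_ne_zero n) 2
  have hvolS : ∀ a, volume (P a (κ a - 3)) ≤ 2 ^ (3 * n) * volume (P a (κ a)) := by
    intro a
    obtain ⟨j, hj, hj'⟩ : ∃ j ≤ 3, κ a = (κ a - 3) + j := ⟨κ a - (κ a - 3), by omega, by omega⟩
    have h := hvol a a (κ a - 3) j
    rw [← hj'] at h
    rw [h]
    gcongr
    norm_num
  -- Going up three generations multiplies the radius by `8 ≥ 5 + 1`, enough to absorb the Vitali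
  -- enlargement. If `κ x < 3`, truncated subtraction gives generation `0`, which is `Q` itself.
  refine ⟨u, fun x => Z x (κ x), fun x => Z x (κ x - 3), fun x => ρ (κ x), fun x => ρ (κ x - 3),
    hucount, hud, ?_, ?_, ?_⟩
  · intro a ha
    have ha0 := hut ha
    have hp := hκpos a ha0
    refine ⟨hρpos _, hρpos _, hmono a ha0.1 _ _ (Nat.sub_le _ _), hZsub _ _, hvolS a, ?_, ?_⟩
    -- The parent has not stopped, and its volume is `2^n` times larger: density `2^{-(n+1)}` there
    -- means at most `1/2` here.
    · have h1 := hκ2 a ha0 (κ a - 1) (by omega)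
      have h2 := hvol a a (κ a - 1) 1
      rw [show κ a - 1 + 1 = κ a by omega, one_mul] at h2
      rw [h2, pow_succ, mul_assoc] at h1
      have h3 := (ENNReal.mul_le_mul_iff_right (by positivity) (by finiteness)).1 h1
      refine le_trans ?_ h3
      gcongr
      exact hmono a ha0.1 _ _ (Nat.sub_le _ _)
    · refine le_trans ?_ (hκ2 a ha0 (κ a - 3) (by omega))
      gcongr
  · refine measure_mono_null (t := E \ t₀) (fun x hx => ⟨hx.1, fun hxt => hx.2 ?_⟩) hnull
    obtain ⟨b, hb, hsub⟩ := hucov x hxt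
    have hxb := hsub (hxP x hxt.1 (κ x))
    refine mem_biUnion hb ?_
    have hb0 := hut hb
    rcases le_or_gt 3 (κ b) with h | h
    · refine hZsup b (κ b - 3) ⟨?_, hEQ hx.1⟩
      have h1 : dist x (Z b (κ b)) ≤ 5 * ρ (κ b) := hxb
      have h2 : dist b (Z b (κ b)) ≤ ρ (κ b) := hxP b hb0.1 (κ b)
      have h3 := dist_triangle_right x b (Z b (κ b))
      have h4 := hρadd (κ b - 3) 3
      rw [show κ b - 3 + 3 = κ b by omega] at h4
      have h5 := hρpos (κ b)
      rw [mem_closedBall]; linarith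
    · have : κ b - 3 = 0 := by omega
      change x ∈ P b (κ b - 3)
      rw [this]
      exact (hP0 b).symm ▸ hEQ hx.1
  -- Each stopping cube has volume below `2^{n+1} |E ∩ P|`. The restricted measure is additive over
  -- the disjoint cubes without measurability of `E`.
  · calc ∑' a : u, volume (P a (κ a - 3))
        ≤ ∑' a : u, 2 ^ (4 * n + 1) * volume.restrict E (P a (κ a)) := by
          refine ENNReal.tsum_le_tsum fun a => (hvolS a).trans ?_
          rw [Measure.restrict_apply measurableSet_closedBall, inter_comm,
            show 4 * n + 1 = 3 * n + (n + 1) by ring, pow_add, mul_assoc]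
          gcongr
          exact (hκ1 a (hut a.2)).le
      _ = 2 ^ (4 * n + 1) * volume.restrict E (⋃ a ∈ u, P a (κ a)) := by
          rw [ENNReal.tsum_mul_left, measure_biUnion hucount hud
            fun _ _ => measurableSet_closedBall]
      _ ≤ 2 ^ (4 * n + 1) * volume E := by
          exact mul_le_mul' le_rfl
            ((measure_mono (subset_univ _)).trans_eq (Measure.restrict_apply_univ _))

/-! ### From small density at one level to exponential decay and BMO. -/

/-- **John–Strömberg inequality**: if on every cube `f` differs by at most `L` from a constant
outside a set of small density, then its distribution function decays exponentially. -/
lemma john_stromberg {n : ℕ} {𝕜 : Type*} [RCLike 𝕜] {f : (Fin n → ℝ) → 𝕜}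
    (c : (Fin n → ℝ) → ℝ → 𝕜) {L : ℝ} (hL : 0 ≤ L)
    (h : ∀ x r, 0 < r → 2 ^ (4 * n + 2) * volume {y | y ∈ closedBall x r ∧ L < ‖f y - c x r‖} ≤
      volume (closedBall x r)) (k : ℕ) :
    ∀ x r, 0 < r → 2 ^ k * volume {y | y ∈ closedBall x r ∧ (2 * k + 1) * L < ‖f y - c x r‖} ≤
      volume (closedBall x r) := by
  induction k with
  | zero =>
    intro x r _
    simpa using measure_mono fun y hy => hy.1
  | succ k ih =>
    intro x r hr
    set E := {y | y ∈ closedBall x r ∧ L < ‖f y - c x r‖} with hE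
    set F := {y | y ∈ closedBall x r ∧ (2 * ((k + 1 : ℕ) : ℝ) + 1) * L < ‖f y - c x r‖} with hF
    have hFE : F ⊆ E := by
      refine fun y hy => ⟨hy.1, lt_of_le_of_lt ?_ hy.2⟩
      exact le_mul_of_one_le_left hL (by linarith [(k + 1).cast_nonneg (α := ℝ)])
    have hsmall : 2 ^ (n + 1) * volume E ≤ volume (closedBall x r) := by
      refine le_trans ?_ (h x r hr)
      exact mul_le_mul' (pow_le_pow_right₀ one_le_two (by omega)) le_rfl
    obtain ⟨t, z, ζ, ρ, σ, htc, -, hprop, hnull, hsum⟩ :=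
      exists_calderon_zygmund_cover x hr (fun y hy => hy.1) hsmall
    have hcover : volume F ≤ ∑' a : t, volume (F ∩ closedBall (ζ a) (σ a)) := by
      have h1 : F ⊆ (⋃ a ∈ t, F ∩ closedBall (ζ a) (σ a)) ∪
          (E \ ⋃ a ∈ t, closedBall (ζ a) (σ a)) := by
        intro y hy
        by_cases hyU : y ∈ ⋃ a ∈ t, closedBall (ζ a) (σ a)
        · left
          simp only [mem_iUnion] at hyU ⊢
          obtain ⟨a, ha, hya⟩ := hyU
          exact ⟨a, ha, hy, hya⟩
        · exact Or.inr ⟨hFE hy, hyU⟩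
      refine (measure_mono h1).trans ((measure_union_le _ _).trans ?_)
      rw [hnull, add_zero]
      exact measure_biUnion_le _ htc _
    have hlocal : ∀ a ∈ t, 2 ^ k * volume (F ∩ closedBall (ζ a) (σ a)) ≤
        volume (closedBall (ζ a) (σ a)) := by
      intro a ha
      obtain ⟨-, hσ, -, -, -, -, hdens⟩ := hprop a ha
      refine le_trans ?_ (ih (ζ a) (σ a) hσ)
      gcongr
      set G := {y | y ∈ closedBall (ζ a) (σ a) ∧ L < ‖f y - c (ζ a) (σ a)‖} with hG
      have hGsmall : 4 * volume G ≤ volume (closedBall (ζ a) (σ a)) := by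
        refine le_trans ?_ (h (ζ a) (σ a) hσ)
        gcongr
        calc (4 : ℝ≥0∞) = 2 ^ 2 := by norm_num
          _ ≤ 2 ^ (4 * n + 2) := by gcongr <;> norm_num
      -- Densities `1/2` of `E` and `1/4` of `G` leave a common good point, so the constants of the
      -- two cubes differ by at most `2L`, the increment per generation.
      obtain ⟨y, hy, hyE, hyG⟩ : ∃ y ∈ closedBall (ζ a) (σ a), y ∉ E ∧ y ∉ G := by
        by_contra! hcon
        have hsub : closedBall (ζ a) (σ a) ⊆ (E ∩ closedBall (ζ a) (σ a)) ∪ G := by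
          intro y hy
          by_cases hyE : y ∈ E
          · exact Or.inl ⟨hyE, hy⟩
          · exact Or.inr (hcon y hy hyE)
        have h1 := (measure_mono hsub).trans (measure_union_le (μ := volume) _ _)
        have hpos := volume_closedBall_pos (ζ a) hσ
        have htop := volume_closedBall_ne_top (ζ a) (σ a)
        have hE' : volume (E ∩ closedBall (ζ a) (σ a)) ≠ ∞ :=
          measure_ne_top_of_subset inter_subset_right htop
        have hG' : volume G ≠ ∞ := measure_ne_top_of_subset (fun y hy => hy.1) htop
        lift volume (closedBall (ζ a) (σ a)) to NNReal using htop with V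
        lift volume (E ∩ closedBall (ζ a) (σ a)) to NNReal using hE' with e
        lift volume G to NNReal using hG' with g
        norm_cast at *
        have : (0 : ℝ) < V := by exact_mod_cast hpos
        have h2 : (2 : ℝ) * e ≤ V := by exact_mod_cast hdens
        have h3 : (4 : ℝ) * g ≤ V := by exact_mod_cast hGsmall
        have h4 : (V : ℝ) ≤ e + g := by exact_mod_cast h1
        linarith
      have hyQ : y ∈ closedBall x r := (hprop a ha).2.2.2.1 hy
      have h1 : ‖f y - c x r‖ ≤ L := by
        by_contra! hlt; exact hyE ⟨hyQ, hlt⟩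
      have h2 : ‖f y - c (ζ a) (σ a)‖ ≤ L := by
        by_contra! hlt; exact hyG ⟨hy, hlt⟩
      rintro v ⟨hvF, hv⟩
      refine ⟨hv, ?_⟩
      have h3 := hvF.2
      have h4 : ‖f v - c x r‖ ≤ ‖f v - c (ζ a) (σ a)‖ + ‖f y - c x r‖ + ‖f y - c (ζ a) (σ a)‖ := by
        calc ‖f v - c x r‖ = ‖(f v - c (ζ a) (σ a)) + (f y - c x r) - (f y - c (ζ a) (σ a))‖ := by
              congr 1; ring
          _ ≤ _ := (norm_sub_le _ _).trans (by gcongr; exact norm_add_le _ _)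
      push_cast at h3
      linarith
    -- The subcubes have total volume at most `2^{4n+1}|E| ≤ |Q|/2`: this is where the exponent
    -- `4n+2` comes from.
    calc 2 ^ (k + 1) * volume F
        ≤ 2 ^ (k + 1) * ∑' a : t, volume (F ∩ closedBall (ζ a) (σ a)) := by gcongr
      _ = 2 * ∑' a : t, 2 ^ k * volume (F ∩ closedBall (ζ a) (σ a)) := by
          rw [ENNReal.tsum_mul_left, pow_succ']; ring
      _ ≤ 2 * ∑' a : t, volume (closedBall (ζ a) (σ a)) := by
          gcongr with a; exact hlocal a a.2
      _ ≤ 2 * (2 ^ (4 * n + 1) * volume E) := by gcongr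
      _ = 2 ^ (4 * n + 2) * volume E := by ring
      _ ≤ _ := h x r hr

/-- A discrete layer-cake bound: beyond `L`, each level `(2k+1)L` exceeded pays for a further `2L`.
-/
lemma enorm_le_add_tsum_indicator {α E : Type*} [NormedAddCommGroup E] (g : α → E) {L : ℝ}
    (hL : 0 < L) (y : α) :
    ‖g y‖ₑ ≤ ENNReal.ofReal L +
      ∑' k : ℕ, {y | (2 * k + 1) * L < ‖g y‖}.indicator (fun _ => ENNReal.ofReal (2 * L)) y := by
  set N := ⌈(‖g y‖ - L) / (2 * L)⌉₊ with hN
  have hsum : (N : ℝ≥0∞) * ENNReal.ofReal (2 * L) ≤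
      ∑' k : ℕ, {y | (2 * k + 1) * L < ‖g y‖}.indicator (fun _ => ENNReal.ofReal (2 * L)) y := by
    refine le_trans (le_of_eq ?_) (ENNReal.sum_le_tsum (Finset.range N))
    rw [Finset.sum_congr rfl fun k hk => indicator_of_mem ?_ _]
    · simp
    · have h1 := Nat.lt_ceil.1 (Finset.mem_range.1 hk)
      rw [lt_div_iff₀ (by positivity)] at h1
      change (2 * (k : ℝ) + 1) * L < ‖g y‖
      linarith
  refine le_trans ?_ (add_le_add_right hsum _)
  have h1 : (‖g y‖ - L) / (2 * L) ≤ N := Nat.le_ceil _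
  rw [div_le_iff₀ (by positivity)] at h1
  rw [← ofReal_norm, ← ENNReal.ofReal_natCast, ← ENNReal.ofReal_mul (by positivity),
    ← ENNReal.ofReal_add hL.le (by positivity)]
  exact ENNReal.ofReal_le_ofReal (by linarith)

lemma tsum_inv_two_pow : ∑' k : ℕ, ((2 : ℝ≥0∞) ^ k)⁻¹ = 2 := by
  simp_rw [ENNReal.inv_pow]
  rw [ENNReal.tsum_geometric, ENNReal.one_sub_inv_two, inv_inv]

/-- The constant is `L + 2L ∑ 2^{-k} = 5L`. -/
lemma lintegral_enorm_le_of_exponential_decay {α E : Type*} [MeasurableSpace α] {μ : Measure α}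
    [NormedAddCommGroup E] {g : α → E} (hg : AEStronglyMeasurable g μ) {L : ℝ} (hL : 0 < L)
    (h : ∀ k : ℕ, 2 ^ k * μ {y | (2 * k + 1) * L < ‖g y‖} ≤ μ univ) :
    ∫⁻ y, ‖g y‖ₑ ∂μ ≤ ENNReal.ofReal (5 * L) * μ univ := by
  have hmeas : ∀ k : ℕ, NullMeasurableSet {y | (2 * k + 1) * L < ‖g y‖} μ := fun k =>
    nullMeasurableSet_lt aemeasurable_const hg.norm.aemeasurable
  calc ∫⁻ y, ‖g y‖ₑ ∂μ
      ≤ ∫⁻ y, (ENNReal.ofReal L + ∑' k : ℕ,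
          {y | (2 * k + 1) * L < ‖g y‖}.indicator (fun _ => ENNReal.ofReal (2 * L)) y) ∂μ :=
        lintegral_mono fun y => enorm_le_add_tsum_indicator g hL y
    _ = ENNReal.ofReal L * μ univ +
          ∑' k : ℕ, ENNReal.ofReal (2 * L) * μ {y | (2 * k + 1) * L < ‖g y‖} := by
        rw [lintegral_add_left measurable_const, lintegral_const, lintegral_tsum]
        · simp_rw [lintegral_indicator_const₀ (hmeas _)]
        · exact fun k => (aemeasurable_const.indicator₀ (hmeas k))
    _ ≤ ENNReal.ofReal L * μ univ +
          ∑' k : ℕ, ENNReal.ofReal (2 * L) * μ univ * ((2 : ℝ≥0∞) ^ k)⁻¹ := by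
        refine add_le_add le_rfl (ENNReal.tsum_le_tsum fun k => ?_)
        rw [mul_assoc, ← div_eq_mul_inv]
        refine mul_le_mul' le_rfl ?_
        rw [ENNReal.le_div_iff_mul_le (Or.inl (by positivity)) (Or.inl (by finiteness)), mul_comm]
        exact h k
    _ = ENNReal.ofReal (5 * L) * μ univ := by
        rw [ENNReal.tsum_mul_left, tsum_inv_two_pow, mul_right_comm, ← add_mul,
          show (2 : ℝ≥0∞) = ENNReal.ofReal 2 by simp, ← ENNReal.ofReal_mul (by positivity),
          ← ENNReal.ofReal_add hL.le (by positivity)]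
        ring_nf

lemma integrableOn_of_lintegral_enorm_sub_le {α E : Type*} [MeasurableSpace α] {μ : Measure α}
    [NormedAddCommGroup E] {f : α → E} {s : Set α} (hf : AEStronglyMeasurable f μ)
    (hs : μ s ≠ ∞) {c : E} {A : ℝ≥0∞} (hA : A ≠ ∞)
    (h : ∫⁻ y in s, ‖f y - c‖ₑ ∂μ ≤ A) : IntegrableOn f s μ := by
  have h1 : IntegrableOn (fun y => f y - c) s μ :=
    ⟨(hf.sub aestronglyMeasurable_const).restrict, h.trans_lt hA.lt_top⟩
  have h2 := h1.add (integrableOn_const hs : IntegrableOn (fun _ => c) s μ)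
  refine h2.congr_fun_ae (Eventually.of_forall fun y => ?_)
  simp

/-- The distance from `c` to the average is itself at most the mean of `‖f - c‖`, whence the factor
`2`. -/
lemma setLAverage_enorm_sub_setAverage_le {α E : Type*} [MeasurableSpace α] {μ : Measure α}
    [NormedAddCommGroup E] [NormedSpace ℝ E] [CompleteSpace E] {f : α → E} {s : Set α}
    (hs₀ : μ s ≠ 0) (hs : μ s ≠ ∞) (hf : IntegrableOn f s μ) (c : E) :
    ⨍⁻ y in s, ‖f y - ⨍ z in s, f z ∂μ‖ₑ ∂μ ≤ 2 * ⨍⁻ y in s, ‖f y - c‖ₑ ∂μ := by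
  have : IsFiniteMeasure (μ.restrict s) := ⟨by simpa using hs.lt_top⟩
  have : NeZero (μ.restrict s) := ⟨by simpa using hs₀⟩
  set m := ⨍ z in s, f z ∂μ with hm
  have hmc : ‖c - m‖ₑ ≤ ⨍⁻ y in s, ‖f y - c‖ₑ ∂μ := by
    have h1 : ⨍ z in s, (f z - c) ∂μ = m - c := by
      rw [hm, average_eq, average_eq, integral_sub hf (integrable_const c), smul_sub]
      congr 1
      rw [integral_const, smul_smul, inv_mul_cancel₀, one_smul]
      simp [measureReal_def, ENNReal.toReal_eq_zero_iff, hs₀, hs]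
    rw [← enorm_neg, neg_sub, ← h1, average_eq', laverage_eq']
    exact enorm_integral_le_lintegral_enorm _
  calc ⨍⁻ y in s, ‖f y - m‖ₑ ∂μ
      ≤ ⨍⁻ y in s, (‖f y - c‖ₑ + ‖c - m‖ₑ) ∂μ := by
        rw [laverage_eq', laverage_eq']
        refine lintegral_mono fun y => ?_
        rw [← sub_add_sub_cancel (f y) c m]
        exact enorm_add_le _ _
    _ = (⨍⁻ y in s, ‖f y - c‖ₑ ∂μ) + ‖c - m‖ₑ := by
        rw [laverage_eq', lintegral_add_right _ measurable_const, ← laverage_eq', ← laverage_eq',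
          laverage_const]
    _ ≤ _ := by rw [two_mul]; gcongr

/-- Local integrability is a conclusion here: exponential decay makes `f - c` integrable on each
cube. -/
lemma bmoNorm_le_of_small_density {n : ℕ} {𝕜 : Type*} [RCLike 𝕜] {f : (Fin n → ℝ) → 𝕜}
    (hf : AEStronglyMeasurable f volume)
    (c : (Fin n → ℝ) → ℝ → 𝕜) {L : ℝ} (hL : 0 < L)
    (h : ∀ x r, 0 < r → 2 ^ (4 * n + 2) * volume {y | y ∈ closedBall x r ∧ L < ‖f y - c x r‖} ≤
      volume (closedBall x r)) :
    bmoNorm f ≤ ENNReal.ofReal (10 * L) := by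
  have hint : ∀ x r, 0 < r → ∫⁻ y in closedBall x r, ‖f y - c x r‖ₑ ∂volume ≤
      ENNReal.ofReal (5 * L) * volume (closedBall x r) := by
    intro x r hr
    have := lintegral_enorm_le_of_exponential_decay (μ := volume.restrict (closedBall x r))
      (g := fun y => f y - c x r) (hf.sub aestronglyMeasurable_const).restrict hL (fun k => by
        rw [Measure.restrict_apply' measurableSet_closedBall, Measure.restrict_apply_univ,
          inter_comm]
        exact john_stromberg c hL.le h k x r hr)
    rwa [Measure.restrict_apply_univ] at this
  have hion : ∀ x r, 0 < r → IntegrableOn f (closedBall x r) volume := fun x r hr =>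
    integrableOn_of_lintegral_enorm_sub_le hf (volume_closedBall_ne_top x r)
      (ENNReal.mul_ne_top ENNReal.ofReal_ne_top (volume_closedBall_ne_top x r)) (hint x r hr)
  have hloc : LocallyIntegrable f volume := fun x =>
    ⟨closedBall x 1, closedBall_mem_nhds x one_pos, hion x 1 one_pos⟩
  rw [bmoNorm, if_pos hloc]
  refine iSup_le fun x => iSup_le fun r => iSup_le fun hr => ?_
  rw [cube_eq_closedBall x hr.le]
  have hr2 : 0 < r / 2 := by positivity
  have hpos := (volume_closedBall_pos x hr2).ne'
  have htop := volume_closedBall_ne_top x (r / 2)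
  refine (setLAverage_enorm_sub_setAverage_le hpos htop (hion x _ hr2) (c x (r / 2))).trans ?_
  rw [show 10 * L = 2 * (5 * L) by ring, ENNReal.ofReal_mul zero_le_two, ENNReal.ofReal_ofNat]
  gcongr
  rw [setLAverage_eq]
  exact ENNReal.div_le_of_le_mul (hint x _ hr2)

/-! ### Comparison of Lebesgue measure and `A_∞` measure on cubes. -/

lemma IsWeight.aemeasurable {n : ℕ} {w : (Fin n → ℝ) → ℝ} (hw : IsWeight w) :
    AEMeasurable (fun y => ENNReal.ofReal (w y)) volume :=
  hw.1.aestronglyMeasurable.aemeasurable.ennreal_ofReal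

lemma weightMeasure_apply {n : ℕ} (w : (Fin n → ℝ) → ℝ) (s : Set (Fin n → ℝ)) :
    weightMeasure w s = ∫⁻ y in s, ENNReal.ofReal (w y) :=
  withDensity_apply' _ s

lemma weightMeasure_absolutelyContinuous {n : ℕ} (w : (Fin n → ℝ) → ℝ) :
    weightMeasure w ≪ volume :=
  withDensity_absolutelyContinuous _ _

lemma IsWeight.weightMeasure_closedBall_ne_top {n : ℕ} {w : (Fin n → ℝ) → ℝ} (hw : IsWeight w)
    (x : Fin n → ℝ) (r : ℝ) : weightMeasure w (closedBall x r) ≠ ∞ := by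
  rw [weightMeasure_apply]
  have h1 : IntegrableOn w (closedBall x r) volume :=
    hw.1.integrableOn_isCompact (isCompact_closedBall x r)
  refine ((lintegral_mono fun y => ?_).trans_lt h1.2).ne
  exact Real.ofReal_le_enorm _

lemma IsWeight.weightMeasure_closedBall_ne_zero {n : ℕ} {w : (Fin n → ℝ) → ℝ} (hw : IsWeight w)
    (x : Fin n → ℝ) {r : ℝ} (hr : 0 < r) : weightMeasure w (closedBall x r) ≠ 0 := by
  rw [weightMeasure_apply]
  intro h
  rw [lintegral_eq_zero_iff' hw.aemeasurable.restrict] at h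
  have h2 : ∀ᵐ y ∂(volume.restrict (closedBall x r)), False := by
    filter_upwards [h, ae_restrict_of_ae hw.2] with y hy hy'
    simp only [Pi.zero_apply, ENNReal.ofReal_eq_zero] at hy
    exact absurd hy' (not_lt.2 hy)
  rw [ae_iff] at h2
  simp only [not_false_eq_true, ofPred_true, Measure.restrict_apply_univ] at h2
  exact (volume_closedBall_pos x hr).ne' h2

/-- For `1 < s` the `A_s` condition on a cube, tested against a subset of the cube. -/
lemma volume_rpow_mul_weightMeasure_le_of_apConst {n : ℕ} {w : (Fin n → ℝ) → ℝ} (hw : IsWeight w)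
    {s : ℝ} (hs : 1 < s) (x : Fin n → ℝ) {r : ℝ} (hr : 0 < r) {E : Set (Fin n → ℝ)}
    (hE : E ⊆ closedBall x r) :
    volume E ^ s * weightMeasure w (closedBall x r) ≤
      apConst s w * volume (closedBall x r) ^ s * weightMeasure w E := by
  set W : (Fin n → ℝ) → ℝ≥0∞ := fun y => ENNReal.ofReal (w y) with hW
  have hWm : AEMeasurable W volume := hw.aemeasurable
  set V := volume (closedBall x r) with hV
  have hV0 : V ≠ 0 := (volume_closedBall_pos x hr).ne'
  have hVt : V ≠ ∞ := volume_closedBall_ne_top x r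
  have hs0 : 0 < s := by linarith
  have hs1 : 0 < s - 1 := by linarith
  set J := ∫⁻ y in closedBall x r, W y ^ (-(1 / (s - 1))) with hJ
  have hap : weightMeasure w (closedBall x r) * J ^ (s - 1) ≤ apConst s w * V ^ s := by
    have h1 : (⨍⁻ y in cube x (2 * r), W y ∂volume) *
        (⨍⁻ y in cube x (2 * r), W y ^ (-(1 / (s - 1))) ∂volume) ^ (s - 1) ≤ apConst s w :=
      le_iSup_of_le x (le_iSup_of_le (2 * r) (le_iSup_of_le (by positivity) le_rfl))
    rw [cube_eq_closedBall x (by positivity), show 2 * r / 2 = r by ring, setLAverage_eq,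
      setLAverage_eq] at h1
    have h2 : V ^ s = V ^ (s - 1) * V := by
      conv_lhs => rw [show s = (s - 1) + 1 by ring, ENNReal.rpow_add _ _ hV0 hVt, ENNReal.rpow_one]
    calc weightMeasure w (closedBall x r) * J ^ (s - 1)
        = (V * (weightMeasure w (closedBall x r) / V)) * (V * (J / V)) ^ (s - 1) := by
          rw [ENNReal.mul_div_cancel hV0 hVt, ENNReal.mul_div_cancel hV0 hVt]
      _ = ((weightMeasure w (closedBall x r) / V) * (J / V) ^ (s - 1)) * V ^ s := by
          rw [ENNReal.mul_rpow_of_nonneg _ _ hs1.le, h2]; ring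
      _ ≤ apConst s w * V ^ s := by
          rw [weightMeasure_apply]
          exact mul_le_mul' h1 le_rfl
  -- Hölder with exponents `s` and `s/(s-1)` applied to `1 = w^{1/s} w^{-1/s}` on `E`.
  have hholder : volume E ≤ weightMeasure w E ^ (1 / s) * J ^ ((s - 1) / s) := by
    have hpq : s.HolderConjugate (s / (s - 1)) := Real.HolderConjugate.conjExponent hs
    have h1 := ENNReal.lintegral_mul_le_Lp_mul_Lq (volume.restrict E) hpq
      (f := fun y => W y ^ (1 / s)) (g := fun y => W y ^ (-(1 / s)))
      (hWm.restrict.pow_const _) (hWm.restrict.pow_const _)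
    have h2 : ∫⁻ y in E, ((fun y => W y ^ (1 / s)) * fun y => W y ^ (-(1 / s))) y = volume E := by
      rw [lintegral_congr_ae (g := fun _ => 1), setLIntegral_one]
      filter_upwards [ae_restrict_of_ae hw.2] with y hy
      simp only [Pi.mul_apply]
      rw [← ENNReal.rpow_add _ _ (by simpa [hW] using hy) ENNReal.ofReal_ne_top]
      simp
    have h3 : ∀ y, (W y ^ (1 / s)) ^ s = W y := fun y => by
      rw [← ENNReal.rpow_mul, one_div_mul_cancel hs0.ne', ENNReal.rpow_one]
    have h4 : ∀ y, (W y ^ (-(1 / s))) ^ (s / (s - 1)) = W y ^ (-(1 / (s - 1))) := fun y => by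
      rw [← ENNReal.rpow_mul]; congr 1; field_simp
    rw [h2] at h1
    simp only [h3, h4] at h1
    rw [weightMeasure_apply]
    refine h1.trans (mul_le_mul' le_rfl ?_)
    rw [one_div_div]
    exact ENNReal.rpow_le_rpow (lintegral_mono_set hE) (by positivity)
  calc volume E ^ s * weightMeasure w (closedBall x r)
      ≤ (weightMeasure w E ^ (1 / s) * J ^ ((s - 1) / s)) ^ s *
          weightMeasure w (closedBall x r) := by gcongr
    _ = weightMeasure w E * (weightMeasure w (closedBall x r) * J ^ (s - 1)) := by
        rw [ENNReal.mul_rpow_of_nonneg _ _ hs0.le, ← ENNReal.rpow_mul, ← ENNReal.rpow_mul,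
          one_div_mul_cancel hs0.ne', ENNReal.rpow_one, div_mul_cancel₀ _ hs0.ne']
        ring
    _ ≤ weightMeasure w E * (apConst s w * V ^ s) := by gcongr
    _ = _ := by ring

/-- The `A_1` condition on a cube, tested against a subset of the cube. -/
lemma volume_mul_weightMeasure_le_of_aOneConst {n : ℕ} {w : (Fin n → ℝ) → ℝ} (hw : IsWeight w)
    (x : Fin n → ℝ) {r : ℝ} (hr : 0 < r) {E : Set (Fin n → ℝ)} (hE : E ⊆ closedBall x r) :
    volume E * weightMeasure w (closedBall x r) ≤
      aOneConst w * volume (closedBall x r) * weightMeasure w E := by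
  set W : (Fin n → ℝ) → ℝ≥0∞ := fun y => ENNReal.ofReal (w y) with hW
  have hWm : AEMeasurable W volume := hw.aemeasurable
  set V := volume (closedBall x r) with hV
  have hV0 : V ≠ 0 := (volume_closedBall_pos x hr).ne'
  have hVt : V ≠ ∞ := volume_closedBall_ne_top x r
  set M := essSup (fun y => (W y)⁻¹) (volume.restrict (closedBall x r)) with hM
  have hap : weightMeasure w (closedBall x r) * M ≤ aOneConst w * V := by
    have h1 : (⨍⁻ y in cube x (2 * r), W y ∂volume) *
        essSup (fun y => (W y)⁻¹) (volume.restrict (cube x (2 * r))) ≤ aOneConst w :=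
      le_iSup_of_le x (le_iSup_of_le (2 * r) (le_iSup_of_le (by positivity) le_rfl))
    rw [cube_eq_closedBall x (by positivity), show 2 * r / 2 = r by ring, setLAverage_eq,
      ← weightMeasure_apply] at h1
    calc weightMeasure w (closedBall x r) * M
        = (V * (weightMeasure w (closedBall x r) / V)) * M := by
          rw [ENNReal.mul_div_cancel hV0 hVt]
      _ = (weightMeasure w (closedBall x r) / V * M) * V := by ring
      _ ≤ aOneConst w * V := mul_le_mul' h1 le_rfl
  have hEM : volume E ≤ weightMeasure w E * M := by
    have h1 : ∀ᵐ y ∂volume.restrict E, (W y)⁻¹ ≤ M :=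
      ae_restrict_of_ae_restrict_of_subset hE (ENNReal.ae_le_essSup _)
    rw [weightMeasure_apply, ← lintegral_mul_const'' _ hWm.restrict, ← setLIntegral_one]
    refine lintegral_mono_ae ?_
    filter_upwards [h1, ae_restrict_of_ae hw.2] with y hy hy'
    rw [← ENNReal.mul_inv_cancel (a := W y) (by simpa [hW] using hy') ENNReal.ofReal_ne_top]
    exact mul_le_mul' le_rfl hy
  calc volume E * weightMeasure w (closedBall x r)
      ≤ weightMeasure w E * M * weightMeasure w (closedBall x r) := by gcongr
    _ = weightMeasure w E * (weightMeasure w (closedBall x r) * M) := by ring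
    _ ≤ weightMeasure w E * (aOneConst w * V) := by gcongr
    _ = _ := by ring

lemma IsAInfty.isWeight {n : ℕ} {w : (Fin n → ℝ) → ℝ} (hw : IsAInfty w) : IsWeight w := by
  obtain ⟨_, _, h, _⟩ := hw
  exact h

/-- The only consequence of the finite Muckenhoupt constant used below; it puts `A_1` and `A_s` on
the same footing. -/
lemma IsAInfty.exists_volume_rpow_mul_weightMeasure_le {n : ℕ} {w : (Fin n → ℝ) → ℝ}
    (hw : IsAInfty w) :
    ∃ (s : ℝ) (C : ℝ≥0∞), 0 < s ∧ C ≠ ∞ ∧ ∀ x r, 0 < r → ∀ E ⊆ closedBall x r,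
      volume E ^ s * weightMeasure w (closedBall x r) ≤
        C * volume (closedBall x r) ^ s * weightMeasure w E := by
  obtain ⟨s, -, hwt, ⟨rfl, h⟩ | ⟨hs, h⟩⟩ := hw
  · refine ⟨1, aOneConst w, one_pos, h.ne, fun x r hr E hE => ?_⟩
    simpa only [ENNReal.rpow_one] using volume_mul_weightMeasure_le_of_aOneConst hwt x hr hE
  · exact ⟨s, apConst s w, by linarith, h.ne, fun x r hr E hE =>
      volume_rpow_mul_weightMeasure_le_of_apConst hwt hs x hr hE⟩

/-- Subsets of a cube of small Lebesgue measure have small `A_∞` measure, with geometric control. -/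
lemma IsAInfty.exists_weightMeasure_le_pow_mul {n : ℕ} {w : (Fin n → ℝ) → ℝ} (hw : IsAInfty w) :
    ∃ γ : ℝ≥0∞, γ < 1 ∧ ∀ (m : ℕ) x r, 0 < r → ∀ E ⊆ closedBall x r,
      NullMeasurableSet E volume →
      2 ^ ((4 * n + 1) * (m + 1)) * volume E ≤ volume (closedBall x r) →
      weightMeasure w E ≤ γ ^ m * weightMeasure w (closedBall x r) := by
  obtain ⟨s, C, hs, hC, hcomp⟩ := hw.exists_volume_rpow_mul_weightMeasure_le
  set B : ℝ≥0∞ := C * (2 ^ (3 * n + 1)) ^ s with hB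
  have hBt : B ≠ ∞ := ENNReal.mul_ne_top hC (ENNReal.rpow_ne_top_of_nonneg hs.le (by finiteness))
  have hB1 : B + 1 ≠ ∞ := by finiteness
  refine ⟨B / (B + 1), ENNReal.div_lt_of_lt_mul (by
    rw [one_mul]; exact ENNReal.lt_add_right hBt one_ne_zero), fun m => ?_⟩
  induction m with
  | zero =>
    intro x r _ E hE _ _
    simpa using measure_mono hE
  | succ m ih =>
    intro x r hr E hEQ hEm hE
    have hsmall : 2 ^ (n + 1) * volume E ≤ volume (closedBall x r) := by
      refine le_trans ?_ hE
      exact mul_le_mul' (pow_le_pow_right₀ one_le_two (by nlinarith)) le_rfl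
    obtain ⟨t, z, ζ, ρ, σ, htc, htd, hprop, hnull, hsum⟩ :=
      exists_calderon_zygmund_cover x hr hEQ hsmall
    set U := ⋃ a ∈ t, closedBall (ζ a) (σ a) with hU
    have hUm : MeasurableSet U := MeasurableSet.biUnion htc fun _ _ => measurableSet_closedBall
    have hUQ : U ⊆ closedBall x r := iUnion₂_subset fun a ha => (hprop a ha).2.2.2.1
    -- `E` fills at most half of the inner cube, so the rest of that cube is a fixed fraction of the
    -- outer one, in volume and hence in weight.
    have hlocal : ∀ a ∈ t, weightMeasure w (closedBall (ζ a) (σ a)) ≤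
        B * weightMeasure w (closedBall (z a) (ρ a) \ E) := by
      intro a ha
      obtain ⟨hρ, hσ, hsub, -, hvol, hdens, -⟩ := hprop a ha
      set V := volume (closedBall (ζ a) (σ a)) with hV
      have hV0 : V ≠ 0 := (volume_closedBall_pos _ hσ).ne'
      have hVt : V ≠ ∞ := volume_closedBall_ne_top _ _
      have h1 : V ≤ 2 ^ (3 * n + 1) * volume (closedBall (z a) (ρ a) \ E) := by
        have hPt := volume_closedBall_ne_top (z a) (ρ a)
        have h2 : volume (closedBall (z a) (ρ a)) ≤
            2 * volume (closedBall (z a) (ρ a) \ E) := by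
          have h3 := measure_inter_add_sdiff₀ (closedBall (z a) (ρ a)) hEm
          rw [inter_comm] at h3
          have h4 : volume (E ∩ closedBall (z a) (ρ a)) ≠ ∞ :=
            measure_ne_top_of_subset inter_subset_right hPt
          have h5 : 2 * volume (E ∩ closedBall (z a) (ρ a)) + volume (closedBall (z a) (ρ a)) ≤
              2 * volume (E ∩ closedBall (z a) (ρ a)) +
                2 * volume (closedBall (z a) (ρ a) \ E) := by
            rw [← mul_add, h3, two_mul (volume (closedBall (z a) (ρ a)))]
            gcongr
          exact (ENNReal.add_le_add_iff_left (by finiteness)).1 h5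
        calc V ≤ 2 ^ (3 * n) * volume (closedBall (z a) (ρ a)) := hvol
          _ ≤ 2 ^ (3 * n) * (2 * volume (closedBall (z a) (ρ a) \ E)) := by gcongr
          _ = _ := by ring
      have h6 := hcomp (ζ a) (σ a) hσ _ (sdiff_subset.trans hsub : closedBall (z a) (ρ a) \ E ⊆ _)
      have hVs0 : V ^ s ≠ 0 := by simp [ENNReal.rpow_eq_zero_iff, hV0, hVt]
      have hVst : V ^ s ≠ ∞ := ENNReal.rpow_ne_top_of_nonneg hs.le hVt
      rw [← ENNReal.mul_le_mul_iff_right hVs0 hVst]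
      calc V ^ s * weightMeasure w (closedBall (ζ a) (σ a))
          ≤ (2 ^ (3 * n + 1) * volume (closedBall (z a) (ρ a) \ E)) ^ s *
              weightMeasure w (closedBall (ζ a) (σ a)) := by gcongr
        _ = (2 ^ (3 * n + 1)) ^ s * (volume (closedBall (z a) (ρ a) \ E) ^ s *
              weightMeasure w (closedBall (ζ a) (σ a))) := by
            rw [ENNReal.mul_rpow_of_nonneg _ _ hs.le, mul_assoc]
        _ ≤ (2 ^ (3 * n + 1)) ^ s *
              (C * V ^ s * weightMeasure w (closedBall (z a) (ρ a) \ E)) := by gcongr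
        _ = _ := by rw [hB]; ring
    have hUdiff : weightMeasure w U ≤ B * weightMeasure w (U \ E) := by
      calc weightMeasure w U ≤ ∑' a : t, weightMeasure w (closedBall (ζ a) (σ a)) :=
            measure_biUnion_le _ htc _
        _ ≤ ∑' a : t, B * (weightMeasure w).restrict Eᶜ (closedBall (z a) (ρ a)) := by
            refine ENNReal.tsum_le_tsum fun a => (hlocal a a.2).trans ?_
            rw [Measure.restrict_apply measurableSet_closedBall, sdiff_eq]
        _ = B * (weightMeasure w).restrict Eᶜ (⋃ a ∈ t, closedBall (z a) (ρ a)) := by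
            rw [ENNReal.tsum_mul_left, measure_biUnion htc htd
              fun _ _ => measurableSet_closedBall]
        _ ≤ B * (weightMeasure w).restrict Eᶜ U :=
            mul_le_mul' le_rfl (measure_mono (iUnion₂_mono fun a ha => (hprop a ha).2.2.1))
        _ = B * weightMeasure w (U \ E) := by rw [Measure.restrict_apply hUm, sdiff_eq]
    have hEU : weightMeasure w E + weightMeasure w (U \ E) ≤ weightMeasure w U := by
      have h1 : weightMeasure w E ≤ weightMeasure w (U ∩ E) := by
        have h2 : weightMeasure w (E \ U) = 0 := weightMeasure_absolutelyContinuous w hnull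
        calc weightMeasure w E ≤ weightMeasure w ((U ∩ E) ∪ (E \ U)) :=
              measure_mono fun y hy => by
                by_cases hyU : y ∈ U
                · exact Or.inl ⟨hyU, hy⟩
                · exact Or.inr ⟨hy, hyU⟩
          _ ≤ _ := measure_union_le _ _
          _ = _ := by rw [h2, add_zero]
      rw [← measure_inter_add_sdiff₀ U (hEm.mono_ac (weightMeasure_absolutelyContinuous w))]
      gcongr
    -- From `w(U) ≤ B w(U \ E)` and `w(E) + w(U \ E) ≤ w(U)`: passing from `U` to `E` gains the
    -- factor `B/(B+1) < 1`.
    have hgain : weightMeasure w E ≤ B / (B + 1) * weightMeasure w U := by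
      rw [← ENNReal.mul_div_right_comm, ENNReal.le_div_iff_mul_le (Or.inl (by simp)) (Or.inl hB1)]
      calc weightMeasure w E * (B + 1) = B * weightMeasure w E + weightMeasure w E := by ring
        _ ≤ B * weightMeasure w E + weightMeasure w U := by
            exact add_le_add le_rfl (le_self_add.trans hEU)
        _ ≤ B * weightMeasure w E + B * weightMeasure w (U \ E) := by gcongr
        _ = B * (weightMeasure w E + weightMeasure w (U \ E)) := by ring
        _ ≤ B * weightMeasure w U := by gcongr
    -- Passing from `E` to `U` costs one factor `2^{4n+1}` in volume, so the induction hypothesis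
    -- applies to `U`.
    have hUvol : 2 ^ ((4 * n + 1) * (m + 1)) * volume U ≤ volume (closedBall x r) := by
      refine le_trans ?_ hE
      rw [show (4 * n + 1) * (m + 1 + 1) = (4 * n + 1) * (m + 1) + (4 * n + 1) by ring,
        pow_add, mul_assoc]
      gcongr
      exact (measure_biUnion_le _ htc _).trans hsum
    calc weightMeasure w E ≤ B / (B + 1) * weightMeasure w U := hgain
      _ ≤ B / (B + 1) * ((B / (B + 1)) ^ m * weightMeasure w (closedBall x r)) := by
          gcongr; exact ih x r hr U hUQ hUm.nullMeasurableSet hUvol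
      _ = _ := by rw [pow_succ']; ring

/-! ### The two norm inequalities. -/

/-- Replaces a norm that may be `0` or `∞` by a positive real strictly above it, which leaves room
for infima that are not attained. -/
lemma ENNReal.le_ofReal_mul_of_forall_lt {X Y : ℝ≥0∞} {C : ℝ} (hC : 0 < C)
    (h : ∀ A : ℝ, 0 < A → Y < ENNReal.ofReal A → X ≤ ENNReal.ofReal (C * A)) :
    X ≤ ENNReal.ofReal C * Y := by
  rcases eq_or_ne Y ∞ with rfl | hY
  · rw [ENNReal.mul_top (by simpa using hC)]
    exact le_top
  refine ENNReal.le_of_forall_pos_le_add fun ε hε _ => ?_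
  have hε' : (0 : ℝ) < ε := hε
  have hA : 0 < Y.toReal + ε / C := by positivity
  have hYA : Y < ENNReal.ofReal (Y.toReal + ε / C) := by
    rw [ENNReal.lt_ofReal_iff_toReal_lt hY]
    linarith [div_pos hε' hC]
  refine (h _ hA hYA).trans ?_
  rw [mul_add, mul_div_cancel₀ _ hC.ne', ENNReal.ofReal_add (by positivity) hε'.le,
    ENNReal.ofReal_mul hC.le, ENNReal.ofReal_toReal hY, ENNReal.ofReal_coe_nnreal]

lemma nullMeasurableSet_lt_norm_sub {n : ℕ} {𝕜 : Type*} [RCLike 𝕜] {f : (Fin n → ℝ) → 𝕜}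
    (hf : AEStronglyMeasurable f volume) (c : 𝕜) (x : Fin n → ℝ) (r t : ℝ) :
    NullMeasurableSet {y | y ∈ closedBall x r ∧ t < ‖f y - c‖} volume :=
  measurableSet_closedBall.nullMeasurableSet.inter (nullMeasurableSet_lt aemeasurable_const
    (hf.sub aestronglyMeasurable_const).norm.aemeasurable)

/-- Chebyshev's inequality for the mean oscillation. -/
lemma ofReal_mul_volume_le_of_bmoNorm_le {n : ℕ} {𝕜 : Type*} [RCLike 𝕜] {f : (Fin n → ℝ) → 𝕜}
    (hf : AEStronglyMeasurable f volume) {A : ℝ≥0∞} (hA : bmoNorm f ≤ A) (hAt : A ≠ ∞)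
    (x : Fin n → ℝ) {r : ℝ} (hr : 0 < r) (t : ℝ) :
    ENNReal.ofReal t *
      volume {y | y ∈ closedBall x r ∧ t < ‖f y - ⨍ z in closedBall x r, f z‖} ≤
        A * volume (closedBall x r) := by
  have hloc : LocallyIntegrable f volume := by
    by_contra hloc
    rw [bmoNorm, if_neg hloc] at hA
    exact hAt (top_le_iff.1 hA)
  have h1 : (⨍⁻ y in closedBall x r, ‖f y - ⨍ z in closedBall x r, f z‖ₑ ∂volume) ≤ A := by
    rw [bmoNorm, if_pos hloc] at hA
    have h2 : (⨍⁻ y in cube x (2 * r), ‖f y - ⨍ z in cube x (2 * r), f z‖ₑ ∂volume) ≤ A := by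
      refine le_trans ?_ hA
      exact le_iSup_of_le x (le_iSup_of_le (2 * r) (le_iSup_of_le (mul_pos two_pos hr) le_rfl))
    rwa [cube_eq_closedBall x (by positivity), show 2 * r / 2 = r by ring] at h2
  rw [setLAverage_eq, ENNReal.div_le_iff (volume_closedBall_pos x hr).ne'
    (volume_closedBall_ne_top x r)] at h1
  refine le_trans ?_ h1
  have h3 := mul_meas_ge_le_lintegral₀ (μ := volume.restrict (closedBall x r))
    (f := fun y => ‖f y - ⨍ z in closedBall x r, f z‖ₑ)
    (hf.sub aestronglyMeasurable_const).restrict.enorm (ENNReal.ofReal t)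
  rw [Measure.restrict_apply' measurableSet_closedBall] at h3
  refine le_trans (mul_le_mul' le_rfl (measure_mono ?_)) h3
  refine fun y hy => ⟨?_, hy.1⟩
  change ENNReal.ofReal t ≤ ‖f y - ⨍ z in closedBall x r, f z‖ₑ
  rw [← ofReal_norm]
  exact ENNReal.ofReal_le_ofReal hy.2.le

lemma exists_add_two_mul_pow_le {q : ℝ} (hq : 0 ≤ q) (hq1 : q < 1) :
    ∃ b : ℝ, 1 ≤ b ∧ ∀ m : ℕ, ((m : ℝ) + 2) * q ^ m ≤ b := by
  have h := (tendsto_self_mul_const_pow_of_lt_one hq hq1).add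
    ((tendsto_pow_atTop_nhds_zero_of_lt_one hq hq1).const_mul 2)
  obtain ⟨b, hb⟩ := h.bddAbove_range
  refine ⟨max 1 b, le_max_left _ _, fun m => le_trans ?_ (le_max_right _ _)⟩
  rw [add_mul]
  exact hb ⟨m, rfl⟩

/-- Geometric decay of a distribution function along an arithmetic progression bounds the weak
`L^p` quasinorm. -/
lemma exists_weak_type_bound_of_geometric_decay {γ : ℝ≥0∞} (hγ : γ < 1) {p : ℝ} (hp : 0 < p) :
    ∃ b : ℝ, 1 ≤ b ∧ ∀ (M : ℝ) (W : ℝ≥0∞) (d : ℝ → ℝ≥0∞), 0 < M → Antitone d →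
      (∀ t, d t ≤ W) → (∀ m : ℕ, d ((m + 1) * M) ≤ γ ^ m * W) →
      ∀ t, 0 < t → ENNReal.ofReal t * d t ^ (1 / p) ≤ ENNReal.ofReal (b * M) * W ^ (1 / p) := by
  have hp' : 0 < 1 / p := by positivity
  have hq1 : γ ^ (1 / p) < 1 := ENNReal.rpow_lt_one hγ hp'
  have hqt : γ ^ (1 / p) ≠ ∞ := (hq1.trans ENNReal.one_lt_top).ne
  obtain ⟨b, hb1, hb⟩ := exists_add_two_mul_pow_le (q := (γ ^ (1 / p)).toReal)
    ENNReal.toReal_nonneg (by simpa using (ENNReal.toReal_lt_toReal hqt ENNReal.one_ne_top).2 hq1)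
  refine ⟨b, hb1, fun M W d hM hd hdW hdecay t ht => ?_⟩
  rcases lt_or_ge t M with htM | htM
  · have h1 : t ≤ b * M := htM.le.trans (le_mul_of_one_le_left hM.le hb1)
    gcongr
    exact hdW t
  -- With `m = ⌊t/M⌋ - 1`, the product is controlled by `(m+2) q^m` for `q = γ^{1/p} < 1`, which `b`
  -- bounds.
  · obtain ⟨m, hm1, hm2⟩ : ∃ m : ℕ, (m + 1) * M ≤ t ∧ t ≤ (m + 2) * M := by
      have h1 : 1 ≤ ⌊t / M⌋₊ := Nat.le_floor (by rw [Nat.cast_one, one_le_div hM]; exact htM)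
      have h2 : (⌊t / M⌋₊ : ℝ) ≤ t / M := Nat.floor_le (by positivity)
      have h3 : t / M < ⌊t / M⌋₊ + 1 := Nat.lt_floor_add_one _
      rw [le_div_iff₀ hM] at h2
      rw [div_lt_iff₀ hM] at h3
      refine ⟨⌊t / M⌋₊ - 1, ?_, ?_⟩
      · push_cast [h1]; linarith
      · push_cast [h1]; linarith
    calc ENNReal.ofReal t * d t ^ (1 / p)
        ≤ ENNReal.ofReal ((m + 2) * M) * (γ ^ m * W) ^ (1 / p) := by
          gcongr
          exact (hd hm1).trans (hdecay m)
      _ = ENNReal.ofReal (((m : ℝ) + 2) * M) * ENNReal.ofReal ((γ ^ (1 / p)).toReal ^ m) *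
            W ^ (1 / p) := by
          rw [ENNReal.mul_rpow_of_nonneg _ _ hp'.le, ENNReal.ofReal_pow ENNReal.toReal_nonneg,
            ENNReal.ofReal_toReal hqt, ← ENNReal.rpow_natCast, ← ENNReal.rpow_natCast,
            ← ENNReal.rpow_mul, ← ENNReal.rpow_mul, mul_comm (m : ℝ) (1 / p), mul_assoc]
      _ ≤ _ := by
          rw [← ENNReal.ofReal_mul (by positivity)]
          gcongr ENNReal.ofReal ?_ * _
          calc ((m : ℝ) + 2) * M * (γ ^ (1 / p)).toReal ^ m
              = (((m : ℝ) + 2) * (γ ^ (1 / p)).toReal ^ m) * M := by ring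
            _ ≤ b * M := by gcongr; exact hb m

lemma IsAInfty.exists_weakOscNorm_le_mul_bmoNorm {n : ℕ} {w : (Fin n → ℝ) → ℝ} (hw : IsAInfty w)
    {p : ℝ} (hp : 0 < p) :
    ∃ C : ℝ, 0 < C ∧ ∀ {𝕜 : Type*} [RCLike 𝕜] (f : (Fin n → ℝ) → 𝕜),
      AEStronglyMeasurable f volume → weakOscNorm w p f ≤ ENNReal.ofReal C * bmoNorm f := by
  obtain ⟨γ, hγ1, hγ⟩ := hw.exists_weightMeasure_le_pow_mul
  obtain ⟨b, hb1, hb⟩ := exists_weak_type_bound_of_geometric_decay hγ1 hp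
  -- Taking `k = (4n+1)(m+1)` in `john_stromberg` gives the level `(2k+1)L ≤ (8n+3)(m+1)L`; the
  -- factor `2^{4n+2}` is Chebyshev's.
  refine ⟨b * ((8 * n + 3) * 2 ^ (4 * n + 2)), by positivity, fun {𝕜} _ f hf =>
    ENNReal.le_ofReal_mul_of_forall_lt (by positivity) fun A hA hfA => ?_⟩
  set L : ℝ := 2 ^ (4 * n + 2) * A with hL
  have hLpos : 0 < L := by positivity
  set c := fun (x : Fin n → ℝ) (r : ℝ) => ⨍ z in closedBall x r, f z with hc
  have hsmall : ∀ x r, 0 < r →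
      2 ^ (4 * n + 2) * volume {y | y ∈ closedBall x r ∧ L < ‖f y - c x r‖} ≤
        volume (closedBall x r) := by
    intro x r hr
    have h1 := ofReal_mul_volume_le_of_bmoNorm_le hf hfA.le ENNReal.ofReal_ne_top x hr L
    rw [hL, mul_comm _ A, ENNReal.ofReal_mul hA.le, mul_assoc, ENNReal.mul_le_mul_iff_right
      (by simpa using hA) ENNReal.ofReal_ne_top, ENNReal.ofReal_pow zero_le_two,
      ENNReal.ofReal_ofNat, mul_comm A] at h1
    exact h1
  have hjs := john_stromberg c hLpos.le hsmall
  refine iSup_le fun x => iSup_le fun r => iSup_le fun hr => iSup_le fun t => iSup_le fun ht =>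
    iInf_le_of_le (c x (r / 2)) ?_
  have hr2 : 0 < r / 2 := by positivity
  rw [cube_eq_closedBall x hr.le]
  set W := weightMeasure w (closedBall x (r / 2)) with hW
  have hdecay := hb ((8 * n + 3) * L) W
    (fun t => weightMeasure w {y | y ∈ closedBall x (r / 2) ∧ t < ‖f y - c x (r / 2)‖})
    (by positivity) (fun s t hst => measure_mono fun y hy => ⟨hy.1, hst.trans_lt hy.2⟩)
    (fun t => measure_mono fun y hy => hy.1) (fun m => by
      have h1 := hγ m x _ hr2 _ (fun y hy => hy.1) (nullMeasurableSet_lt_norm_sub hf _ _ _ _)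
        (hjs ((4 * n + 1) * (m + 1)) x _ hr2)
      refine (measure_mono ?_).trans h1
      refine fun y hy => ⟨hy.1, lt_of_le_of_lt ?_ hy.2⟩
      rw [← mul_assoc ((m : ℝ) + 1)]
      refine mul_le_mul_of_nonneg_right ?_ hLpos.le
      push_cast
      nlinarith [m.cast_nonneg (α := ℝ), n.cast_nonneg (α := ℝ)]) t ht
  rw [ENNReal.div_eq_inv_mul, mul_assoc, mul_comm, ← div_eq_mul_inv]
  refine ENNReal.div_le_of_le_mul (hdecay.trans_eq ?_)
  rw [hL]
  ring_nf

lemma IsAInfty.exists_bmoNorm_le_mul_weakOscNorm {n : ℕ} {w : (Fin n → ℝ) → ℝ} (hw : IsAInfty w)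
    {p : ℝ} (hp : 0 < p) :
    ∃ C : ℝ, 0 < C ∧ ∀ {𝕜 : Type*} [RCLike 𝕜] (f : (Fin n → ℝ) → 𝕜),
      AEStronglyMeasurable f volume → bmoNorm f ≤ ENNReal.ofReal C * weakOscNorm w p f := by
  obtain ⟨s, C, hs, hC, hcomp⟩ := hw.exists_volume_rpow_mul_weightMeasure_le
  set D : ℝ≥0∞ := (2 ^ (4 * n + 2)) ^ s * C with hD
  have hDt : D ≠ ∞ := ENNReal.mul_ne_top (ENNReal.rpow_ne_top_of_nonneg hs.le (by finiteness)) hC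
  have hp' : 0 < 1 / p := by positivity
  have hDp : D ^ (1 / p) ≠ ∞ := ENNReal.rpow_ne_top_of_nonneg hp'.le hDt
  -- Chosen so that `T^p ≥ D`: at level `T A` the exceptional set has `w`-density at most `1/D`,
  -- hence Lebesgue density at most `2^{-(4n+2)}`. The `+ 1` only ensures positivity.
  set T : ℝ := (D ^ (1 / p)).toReal + 1 with hT
  have hTpos : 0 < T := by positivity
  have hDT : D ≤ ENNReal.ofReal T ^ p := by
    calc D = (D ^ (1 / p)) ^ p := by
          rw [← ENNReal.rpow_mul, one_div_mul_cancel hp.ne', ENNReal.rpow_one]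
      _ ≤ ENNReal.ofReal T ^ p := by
          gcongr
          rw [← ENNReal.ofReal_toReal hDp]
          exact ENNReal.ofReal_le_ofReal (by simp [hT])
  refine ⟨10 * T, by positivity, fun {𝕜} _ f hf =>
    ENNReal.le_ofReal_mul_of_forall_lt (by positivity) fun A hA hfA => ?_⟩
  have hex : ∀ x r, ∃ c, 0 < r →
      2 ^ (4 * n + 2) * volume {y | y ∈ closedBall x r ∧ T * A < ‖f y - c‖} ≤
        volume (closedBall x r) := by
    intro x r
    by_cases hr : 0 < r
    swap
    · exact ⟨0, fun h => absurd h hr⟩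
    -- Only the level `T * A` is tested, so the constant found depends on the cube alone.
    have h1 : (⨅ c : 𝕜, ENNReal.ofReal (T * A) / weightMeasure w (cube x (2 * r)) ^ (1 / p) *
        weightMeasure w {y | y ∈ cube x (2 * r) ∧ T * A < ‖f y - c‖} ^ (1 / p)) <
          ENNReal.ofReal A := by
      refine lt_of_le_of_lt ?_ hfA
      refine le_iSup_of_le x (le_iSup_of_le (2 * r) (le_iSup_of_le (mul_pos two_pos hr)
        (le_iSup_of_le (T * A) ?_)))
      rw [iSup_pos (mul_pos hTpos hA)]
    obtain ⟨c, hc⟩ := iInf_lt_iff.1 h1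
    rw [cube_eq_closedBall x (by positivity), show 2 * r / 2 = r by ring] at hc
    refine ⟨c, fun _ => ?_⟩
    set E := {y | y ∈ closedBall x r ∧ T * A < ‖f y - c‖} with hE
    set W := weightMeasure w (closedBall x r) with hW
    have hW0 : W ≠ 0 := hw.isWeight.weightMeasure_closedBall_ne_zero x hr
    have hWt : W ≠ ∞ := hw.isWeight.weightMeasure_closedBall_ne_top x _
    have hA0 : ENNReal.ofReal A ≠ 0 := by simpa using hA
    have h2 : ENNReal.ofReal T ^ p * weightMeasure w E ≤ W := by
      have h3 : ENNReal.ofReal T * weightMeasure w E ^ (1 / p) ≤ W ^ (1 / p) := by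
        rw [ENNReal.div_eq_inv_mul, mul_assoc, mul_comm, ← div_eq_mul_inv] at hc
        have h4 := (ENNReal.div_le_iff (by simp [ENNReal.rpow_eq_zero_iff, hW0, hWt])
          (ENNReal.rpow_ne_top_of_nonneg hp'.le hWt)).1 hc.le
        rw [mul_comm T, ENNReal.ofReal_mul hA.le, mul_assoc,
          ENNReal.mul_le_mul_iff_right hA0 ENNReal.ofReal_ne_top] at h4
        exact h4
      have h5 := ENNReal.rpow_le_rpow h3 hp.le
      rwa [ENNReal.mul_rpow_of_nonneg _ _ hp.le, ← ENNReal.rpow_mul, ← ENNReal.rpow_mul,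
        one_div_mul_cancel hp.ne', ENNReal.rpow_one, ENNReal.rpow_one] at h5
    have h6 := hcomp x r hr E fun y hy => hy.1
    rw [← ENNReal.rpow_le_rpow_iff hs, ENNReal.mul_rpow_of_nonneg _ _ hs.le,
      ← ENNReal.mul_le_mul_iff_left hW0 hWt]
    calc (2 ^ (4 * n + 2)) ^ s * volume E ^ s * W
        = (2 ^ (4 * n + 2)) ^ s * (volume E ^ s * W) := by ring
      _ ≤ (2 ^ (4 * n + 2)) ^ s * (C * volume (closedBall x r) ^ s * weightMeasure w E) := by
          gcongr
      _ = volume (closedBall x r) ^ s * (D * weightMeasure w E) := by rw [hD]; ring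
      _ ≤ volume (closedBall x r) ^ s * W := by
          gcongr
          exact (mul_le_mul' hDT le_rfl).trans h2
  choose c hc using hex
  rw [mul_assoc]
  exact bmoNorm_le_of_small_density hf c (by positivity) hc

theorem lemma3p2 {n : ℕ} {𝕜 : Type*} [RCLike 𝕜] (w : (Fin n → ℝ) → ℝ) (hw : IsAInfty w)
    (p : ℝ) (hp : 0 < p) :
    ∃ C : ℝ, 0 < C ∧ ∀ f : (Fin n → ℝ) → 𝕜, AEStronglyMeasurable f volume →
      weakOscNorm w p f ≤ ENNReal.ofReal C * bmoNorm f ∧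
      bmoNorm f ≤ ENNReal.ofReal C * weakOscNorm w p f := by
  obtain ⟨C₁, hC₁, h₁⟩ := hw.exists_weakOscNorm_le_mul_bmoNorm hp
  obtain ⟨C₂, hC₂, h₂⟩ := hw.exists_bmoNorm_le_mul_weakOscNorm hp
  refine ⟨max C₁ C₂, lt_max_of_lt_left hC₁, fun f hf => ⟨(h₁ f hf).trans ?_, (h₂ f hf).trans ?_⟩⟩
  · gcongr; exact le_max_left _ _
  · gcongr; exact le_max_right _ _
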